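/- Let $D=(V,A)$ be a finite directed multigraph (loops and parallel arcs allowed), $|A|=m$. An arc parameterization of $D$ is a vector $\Lambda=(\lambda_a)_{a\in A}\in\mathbb{R}_{\ge 0}^{m}$ such that $\lambda_a=0$ only if $a$ is a loop. Its generalized network matrix $N_\Lambda\in\mathbb{R}^{V\times A}$ has the column $e_j-\lambda_a e_i$ for every arc $a=(i,j)$. The generalized flows of $D_\Lambda$ are the elements of $\mathcal{F}(D_\Lambda)=\ker N_\Lambda$, the generalized bonds are the elements of $\mathcal{B}(D_\Lambda)=\operatorname{Im} N_\Lambda^{\top}$. The multiplier of an oriented cycle $C$ of the underlying graph (a loop is a cycle of length $1$) with forward arcs $C^+$ and backward arcs $C^-$ is $\prod_{a\in C^+}\lambda_a\prod_{a\in C^-}\lambda_a^{-1}$; $D_\Lambda$ is breakeven if no loop has parameter $0$ and all cycles have multiplier $1$. Given a non-crossing embedding of $D$ in the sphere (described by the cyclic orders of the arcs around the vertices and by its faces, with connected surface and $|V|-|A|+|F|=1+\#\{\text{components of }D\}$), the planar dual $D^*$ has the faces as vertices and for each $a\in A$ one arc, directed from the face whose clockwise facial walk traverses $a$ backward to the face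 whose clockwise facial walk traverses $a$ forward. Theorem. Let $D_\Lambda$ be a breakeven arc-parameterized digraph, and let $D$ be embedded in the sphere without crossings, with planar dual $D^*$. Then there is an arc parameterization $\Lambda^*$ of $D^*$ such that $\mathcal{F}(D_\Lambda)\cong\mathcal{B}(D^*_{\Lambda^*})$ as real vector spaces. More precisely, there is a vector $\sigma\in\mathbb{R}^m$ with positive components such that, for all $f\in\mathbb{R}^m$, $f$ is a generalized flow of $D_\Lambda$ if and only if $x=S(\sigma)f$ is a generalized bond of $D^*_{\Lambda^*}$, where $S(\sigma)$ is the diagonal matrix with entries from $\sigma$. -/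

import Mathlib

/-- A directed multigraph with vertex set `V` and arc set `A`. Loops and parallel arcs are
allowed. The arc `a` is directed from `src a` to `dst a`. -/
structure MultiDigraph (V A : Type*) where
  src : A → V
  dst : A → V

namespace MultiDigraph

/-- The two oriented traversals (darts) of the arcs: `(a, true)` runs along `a` in forward
direction, `(a, false)` in backward direction. -/
abbrev Dart (A : Type*) := A × Bool

/-- The reversed dart. -/
def Dart.rev {A : Type*} (d : Dart A) : Dart A := (d.1, !d.2)

variable {V A F : Type*}

/-- The vertex where a dart starts. -/
def start (D : MultiDigraph V A) (d : Dart A) : V := if d.2 then D.src d.1 else D.dst d.1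

/-- The vertex where a dart ends. -/
def finish (D : MultiDigraph V A) (d : Dart A) : V := D.start (Dart.rev d)

/-- Number of connected components of the underlying graph (isolated vertices count): the
cardinality of the quotient of `V` by the equivalence relation generated by the arcs. -/
noncomputable def numComponents (D : MultiDigraph V A) : ℕ :=
  Nat.card (Quot fun u v : V => ∃ a : A, D.src a = u ∧ D.dst a = v)

/-- A cycle of the underlying graph, with a cyclic orientation and a starting point, as the
cyclic sequence `c 0, …, c k` of its darts: consecutive darts fit together (`i + 1` is taken
modulo `k + 1`, so the last dart leads back to the start of the first), no vertex is visited twice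
and no arc is used twice. A loop is a cycle of length `1`, two parallel or antiparallel arcs
form a cycle of length `2`. -/
structure IsCycle (D : MultiDigraph V A) {k : ℕ} (c : Fin (k + 1) → Dart A) : Prop where
  closed : ∀ i, D.finish (c i) = D.start (c (i + 1))
  vertex_injective : Function.Injective fun i => D.start (c i)
  arc_injective : Function.Injective fun i => (c i).1

/-- An arc parameterization of `D`: a vector of nonnegative arc weights that may vanish only on
loops. The pair of `D` and `Λ` is an arc-parameterized digraph. -/
structure ArcParam (D : MultiDigraph V A) where
  val : A → ℝ
  nonneg : ∀ a, 0 ≤ val a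
  loop_of_eq_zero : ∀ a, val a = 0 → D.src a = D.dst a

namespace ArcParam

/-- The multiplier of an oriented cycle: the product of the weights of the forward arcs times the
product of the inverses of the weights of the backward arcs. -/
noncomputable def multiplier {D : MultiDigraph V A} (Λ : D.ArcParam) {k : ℕ}
    (c : Fin (k + 1) → Dart A) : ℝ :=
  ∏ i, Λ.val (c i).1 ^ (if (c i).2 then (1 : ℤ) else -1)

/-- All cycles have multiplier `1`. -/
def Breakeven {D : MultiDigraph V A} (Λ : D.ArcParam) : Prop :=
  ∀ (k : ℕ) (c : Fin (k + 1) → Dart A), D.IsCycle c → Λ.multiplier c = 1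

/-- The generalized network matrix: the column of an arc `a = (i, j)` is `e_j - λ_a e_i`. -/
def networkMatrix {D : MultiDigraph V A} [DecidableEq V] (Λ : D.ArcParam) : Matrix V A ℝ :=
  Matrix.of fun v a =>
    (Pi.single (D.dst a) (1 : ℝ) : V → ℝ) v - Λ.val a * (Pi.single (D.src a) (1 : ℝ) : V → ℝ) v

/-- The space of generalized flows, the kernel of the generalized network matrix. -/
def flows {D : MultiDigraph V A} [DecidableEq V] [Fintype A] (Λ : D.ArcParam) :
    Submodule ℝ (A → ℝ) :=
  LinearMap.ker Λ.networkMatrix.mulVecLin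

/-- The space of generalized bonds, the image of the transposed generalized network matrix. -/
def bonds {D : MultiDigraph V A} [DecidableEq V] [Fintype V] (Λ : D.ArcParam) :
    Submodule ℝ (A → ℝ) :=
  LinearMap.range Λ.networkMatrix.transpose.mulVecLin

end ArcParam

/-- Given the face to the right of every dart, the digraph on the faces that has for every arc
`a` an arc from the face to the left of `a` to the face to the right of `a`. -/
def ofFaces (right : Dart A → F) : MultiDigraph F A where
  src a := right (a, false)
  dst a := right (a, true)

/-- A non-crossing embedding of `D` in the sphere with set of faces `F`, given combinatorially
(rotation system of genus `0`). `D` need not be connected.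

* `rot d` is the next dart after `d` in counterclockwise order around the vertex where `d` starts;
  the darts that start at a common vertex form one cyclic order.
* `right d` is the face to the right of the dart `d`. After `d`, the boundary walk with this face
  on its right continues with the counterclockwise successor of the reversed dart. So the orbits
  of `d ↦ rot (rev d)` are the clockwise facial walks; all darts of a facial walk have
  the same face to their right. If `D` is disconnected, a face can have several facial walks.
* `connected`: the surface composed of `D` and the faces is connected, i.e. any two
  faces can be joined by crossing arcs.
* `euler`: the surface is the sphere. By Euler's formula with `C` components,
  `|V| - |A| + |F| = 1 + C`. Together with `connected` this says that each component of `D` is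
  embedded with genus `0`, and that the components and faces are arranged in a treelike way. -/
structure SphereEmbedding [Fintype V] [Fintype A] (D : MultiDigraph V A)
    (F : Type*) [Fintype F] where
  rot : Equiv.Perm (Dart A)
  rot_sameCycle_iff : ∀ d e, rot.SameCycle d e ↔ D.start d = D.start e
  right : Dart A → F
  right_rot_rev : ∀ d, right (rot (Dart.rev d)) = right d
  connected : (ofFaces right).numComponents = 1
  euler : Fintype.card V + Fintype.card F = Fintype.card A + 1 + D.numComponents

/-- The planar dual of an embedded digraph. Its vertices are the faces, and its arcs correspond to
the arcs of `D`. The dual of the arc `a` leaves the face whose clockwise facial walk traverses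
`a` backward and enters the face whose clockwise facial walk traverses `a` forward. -/
def SphereEmbedding.dual [Fintype V] [Fintype A] [Fintype F] {D : MultiDigraph V A}
    (E : D.SphereEmbedding F) : MultiDigraph F A :=
  ofFaces E.right

end MultiDigraph

/-! Breakeven says that the weights have no multiplicative holonomy, so they are quotients of a
positive vertex potential `q` (`exists_potential`). Multiplying conservation at `v` by `q v` shows
that `f` is a generalized flow iff `a ↦ q (D.dst a) * f a` is an ordinary flow. Hence the dual can
carry unit weights, with `σ a = q (D.dst a)`, and what remains is classical planar duality: the
flows of `D` are the bonds of its dual (`bonds_dual_eq_flows`), by an inclusion and Euler's formula.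
-/

namespace MultiDigraph

variable {V A F : Type*}

/-! ### Unit parameters -/

/-- The arc parameterization with all weights equal to `1`. -/
def unitParam (D : MultiDigraph V A) : D.ArcParam where
  val _ := 1
  nonneg _ := zero_le_one
  loop_of_eq_zero _ h := absurd h one_ne_zero

theorem ArcParam.mem_flows_iff {D : MultiDigraph V A} [DecidableEq V] [Fintype A]
    (Λ : D.ArcParam) (f : A → ℝ) :
    f ∈ Λ.flows ↔ ∀ v, ∑ a, ((if D.dst a = v then f a else 0)
      - if D.src a = v then Λ.val a * f a else 0) = 0 := by
  rw [ArcParam.flows, LinearMap.mem_ker, Matrix.mulVecLin_apply, funext_iff]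
  refine forall_congr' fun v => ?_
  simp only [Matrix.mulVec, dotProduct, ArcParam.networkMatrix, Matrix.of_apply, Pi.single_apply,
    Pi.zero_apply]
  refine Eq.congr_left (Finset.sum_congr rfl fun a _ => ?_)
  simp only [eq_comm (a := v)]
  split_ifs <;> ring

theorem ArcParam.transpose_mulVec_apply {D : MultiDigraph V A} [DecidableEq V] [Fintype V]
    (Λ : D.ArcParam) (y : V → ℝ) (a : A) :
    (Λ.networkMatrix.transpose.mulVec y) a = y (D.dst a) - Λ.val a * y (D.src a) := by
  simp [Matrix.mulVec, dotProduct, ArcParam.networkMatrix, sub_mul, Pi.single_apply,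
    Finset.sum_sub_distrib]

/-- The functions killed by the coboundary map are the functions on the set of components. -/
theorem finrank_ker_transpose_unitParam (D : MultiDigraph V A) [DecidableEq V] [Fintype V] :
    Module.finrank ℝ (LinearMap.ker D.unitParam.networkMatrix.transpose.mulVecLin)
      = D.numComponents := by
  classical
  set r : V → V → Prop := fun u v => ∃ a : A, D.src a = u ∧ D.dst a = v with hr
  have : Fintype (Quot r) := Fintype.ofFinite _
  have key : LinearMap.ker D.unitParam.networkMatrix.transpose.mulVecLin
      = LinearMap.range (LinearMap.funLeft ℝ ℝ (Quot.mk r)) := by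
    ext y
    rw [LinearMap.mem_ker, Matrix.mulVecLin_apply, LinearMap.mem_range]
    constructor
    · intro h
      refine ⟨Quot.lift y ?_, rfl⟩
      rintro _ _ ⟨a, rfl, rfl⟩
      have := congrFun h a
      rw [ArcParam.transpose_mulVec_apply] at this
      simp only [unitParam, one_mul, Pi.zero_apply] at this
      linarith
    · rintro ⟨z, rfl⟩
      ext a
      rw [ArcParam.transpose_mulVec_apply]
      have : Quot.mk r (D.src a) = Quot.mk r (D.dst a) := Quot.sound ⟨a, rfl, rfl⟩
      simp [unitParam, LinearMap.funLeft_apply, this]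
  rw [key, LinearMap.finrank_range_of_inj
    (LinearMap.funLeft_injective_of_surjective ℝ ℝ _ Quot.mk_surjective),
    Module.finrank_fintype_fun_eq_card, numComponents, Nat.card_eq_fintype_card]

theorem finrank_bonds_unitParam (D : MultiDigraph V A) [DecidableEq V] [Fintype V] :
    Module.finrank ℝ D.unitParam.bonds + D.numComponents = Fintype.card V := by
  have h := LinearMap.finrank_range_add_finrank_ker
    D.unitParam.networkMatrix.transpose.mulVecLin
  rwa [finrank_ker_transpose_unitParam, Module.finrank_fintype_fun_eq_card] at h

theorem finrank_flows_unitParam (D : MultiDigraph V A) [DecidableEq V] [Fintype V] [Fintype A] :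
    Module.finrank ℝ D.unitParam.flows + Fintype.card V
      = Fintype.card A + D.numComponents := by
  have h := LinearMap.finrank_range_add_finrank_ker D.unitParam.networkMatrix.mulVecLin
  have hb := D.finrank_bonds_unitParam
  have ht : Module.finrank ℝ D.unitParam.bonds = D.unitParam.networkMatrix.rank := by
    classical
    exact Matrix.rank_transpose _
  rw [Module.finrank_fintype_fun_eq_card] at h
  change D.unitParam.networkMatrix.rank + Module.finrank ℝ D.unitParam.flows = _ at h
  omega

/-! ### Bonds of the dual are flows -/

theorem SphereEmbedding.right_rot [Fintype V] [Fintype A] [Fintype F] {D : MultiDigraph V A}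
    (E : D.SphereEmbedding F) (d : Dart A) : E.right (E.rot d) = E.right (Dart.rev d) := by
  have h := E.right_rot_rev (Dart.rev d)
  simpa [Dart.rev] using h

theorem SphereEmbedding.start_rot [Fintype V] [Fintype A] [Fintype F] {D : MultiDigraph V A}
    (E : D.SphereEmbedding F) (d : Dart A) : D.start (E.rot d) = D.start d :=
  ((E.rot_sameCycle_iff _ _).1 ⟨1, by simp⟩).symm

/-- The face to the left of a dart is the face to the right of its `rot`-successor. As `rot`
permutes the darts starting at `v`, the differences of `y` across them cancel in total. -/
theorem SphereEmbedding.bonds_dual_le_flows [Fintype V] [Fintype A] [Fintype F]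
    [DecidableEq V] [DecidableEq F] {D : MultiDigraph V A} (E : D.SphereEmbedding F) :
    E.dual.unitParam.bonds ≤ D.unitParam.flows := by
  rintro _ ⟨y, rfl⟩
  rw [ArcParam.mem_flows_iff]
  intro v
  have hrot : ∑ d : Dart A, (if D.start d = v then y (E.right (E.rot d)) else 0)
      = ∑ d : Dart A, if D.start d = v then y (E.right d) else 0 := by
    rw [← Equiv.sum_comp E.rot fun d => if D.start d = v then y (E.right d) else 0]
    simp only [E.start_rot]
  simp only [E.right_rot, Fintype.sum_prod_type, Fintype.sum_bool, start, Dart.rev] at hrot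
  rw [← sub_eq_zero, ← Finset.sum_sub_distrib] at hrot
  refine (Finset.sum_congr rfl fun a _ => ?_).trans hrot
  rw [Matrix.mulVecLin_apply, ArcParam.transpose_mulVec_apply]
  simp only [unitParam, SphereEmbedding.dual, ofFaces, if_true, Bool.not_true, Bool.not_false,
    Bool.false_eq_true, if_false]
  split_ifs <;> ring

/-- The dimensions are `|F| - 1` and `|A| - |V| + C`, with `C` components of `D`; Euler's formula
equates them. -/
theorem SphereEmbedding.bonds_dual_eq_flows [Fintype V] [Fintype A] [Fintype F]
    [DecidableEq V] [DecidableEq F] {D : MultiDigraph V A} (E : D.SphereEmbedding F) :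
    E.dual.unitParam.bonds = D.unitParam.flows := by
  refine Submodule.eq_of_le_of_finrank_eq E.bonds_dual_le_flows ?_
  have h₁ := E.dual.finrank_bonds_unitParam
  have h₂ := D.finrank_flows_unitParam
  have h₃ : E.dual.numComponents = 1 := E.connected
  have h₄ := E.euler
  omega

/-! ### Walks and potentials -/

/-- The list `l` of darts is a walk from `u` to `v`. -/
def IsWalk (D : MultiDigraph V A) : V → List (Dart A) → V → Prop
  | u, [], v => u = v
  | u, d :: l, v => D.start d = u ∧ D.IsWalk (D.finish d) l v

theorem isWalk_append (D : MultiDigraph V A) {u v : V} {l₁ l₂ : List (Dart A)} :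
    D.IsWalk u (l₁ ++ l₂) v ↔ ∃ w, D.IsWalk u l₁ w ∧ D.IsWalk w l₂ v := by
  induction l₁ generalizing u with
  | nil => simp [IsWalk]
  | cons d l ih => simp [IsWalk, ih, and_assoc]

theorem IsWalk.finish_getElem {D : MultiDigraph V A} {u v : V} {l : List (Dart A)}
    (h : D.IsWalk u l v) (i : ℕ) (hi : i + 1 < l.length) :
    D.finish l[i] = D.start l[i + 1] := by
  induction l generalizing u i with
  | nil => simp at hi
  | cons d l ih =>
    cases i with
    | zero =>
      cases l with
      | nil => simp at hi
      | cons e l => exact h.2.1.symm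
    | succ i => simpa using ih h.2 i (by simpa using hi)

theorem IsWalk.finish_last {D : MultiDigraph V A} {u v : V} {l : List (Dart A)}
    (h : D.IsWalk u l v) (i : ℕ) (hi : i + 1 = l.length) : D.finish l[i] = v := by
  induction l generalizing u i with
  | nil => simp at hi
  | cons d l ih =>
    cases i with
    | zero =>
      cases l with
      | nil => exact h.2
      | cons e l => simp at hi
    | succ i => simpa using ih h.2 i (by simpa using hi)

theorem IsWalk.start_zero {D : MultiDigraph V A} {u v : V} {l : List (Dart A)}
    (h : D.IsWalk u l v) (hl : 0 < l.length) : D.start l[0] = u := by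
  cases l with
  | nil => simp at hl
  | cons d l => exact h.1

theorem _root_.List.exists_append_of_not_nodup_map {α β : Type*} (g : α → β) {l : List α}
    (h : ¬ (l.map g).Nodup) :
    ∃ l₁ x l₂ y l₃, l = l₁ ++ (x :: l₂ ++ y :: l₃) ∧ g x = g y := by
  induction l with
  | nil => simp at h
  | cons x l ih =>
    rw [List.map_cons, List.nodup_cons, not_and_or, not_not] at h
    rcases h with h | h
    · obtain ⟨y, hy, hxy⟩ := List.mem_map.1 h
      obtain ⟨l₂, l₃, rfl⟩ := List.append_of_mem hy
      exact ⟨[], x, l₂, y, l₃, rfl, hxy.symm⟩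
    · obtain ⟨l₁, x', l₂, y, l₃, rfl, hxy⟩ := ih h
      exact ⟨x :: l₁, x', l₂, y, l₃, rfl, hxy⟩

namespace ArcParam

variable {D : MultiDigraph V A} (Λ : D.ArcParam)

/-- The factor that a dart contributes to multipliers. -/
noncomputable def dartWeight (d : Dart A) : ℝ := Λ.val d.1 ^ (if d.2 then (1 : ℤ) else -1)

variable {Λ}

/-- A loop of weight `0` would be a cycle with multiplier `0`. -/
theorem Breakeven.val_pos (h : Λ.Breakeven) (a : A) : 0 < Λ.val a := by
  refine (Λ.nonneg a).lt_of_ne' fun h0 => ?_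
  have hl := Λ.loop_of_eq_zero a h0
  have := h 0 (fun _ => (a, true)) ⟨fun _ => by simp [finish, start, Dart.rev, hl],
    fun i j _ => Subsingleton.elim (α := Fin 1) i j,
    fun i j _ => Subsingleton.elim (α := Fin 1) i j⟩
  simp [multiplier, h0] at this

theorem Breakeven.dartWeight_pos (h : Λ.Breakeven) (d : Dart A) : 0 < Λ.dartWeight d :=
  zpow_pos (h.val_pos _) _

theorem Breakeven.dartWeight_mul_rev (h : Λ.Breakeven) (d : Dart A) :
    Λ.dartWeight d * Λ.dartWeight (Dart.rev d) = 1 := by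
  have := (h.val_pos d.1).ne'
  obtain ⟨a, b⟩ := d
  cases b <;> simp_all [dartWeight, Dart.rev]

/-- With distinct vertices, an arc can repeat only when the walk goes along it and straight back;
the two weights then cancel. -/
theorem Breakeven.prod_eq_one_of_vertex_injective (h : Λ.Breakeven) {k : ℕ}
    {c : Fin (k + 1) → Dart A} (hc : ∀ i, D.finish (c i) = D.start (c (i + 1)))
    (hv : Function.Injective fun i => D.start (c i)) : ∏ i, Λ.dartWeight (c i) = 1 := by
  by_cases ha : Function.Injective fun i => (c i).1
  · exact h k c ⟨hc, hv, ha⟩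
  · obtain ⟨i, j, hij, hne⟩ : ∃ i j, (c i).1 = (c j).1 ∧ i ≠ j := by
      simpa [Function.Injective] using ha
    -- Equal directions would give equal start vertices.
    have hrev : c j = Dart.rev (c i) := by
      refine Prod.ext hij.symm ?_
      by_contra hb
      refine hne (hv (congrArg D.start (Prod.ext hij ?_)))
      change (c j).2 ≠ !(c i).2 at hb
      revert hb
      cases (c i).2 <;> cases (c j).2 <;> simp
    have hrev' : c i = Dart.rev (c j) := by rw [hrev]; simp [Dart.rev]
    have h₁ : j = i + 1 := hv (by
      change D.start (c j) = D.start (c (i + 1))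
      rw [← hc, hrev, finish])
    have h₂ : i = j + 1 := hv (by
      change D.start (c i) = D.start (c (j + 1))
      rw [← hc, hrev', finish])
    -- Now `i = i + 2` modulo `k + 1`, so `k + 1` divides `2`; `k = 0` would force `i = j`.
    have hk : k = 1 := by
      rw [h₁, Fin.ext_iff, Fin.val_add, Fin.val_add] at h₂
      have hi := i.isLt
      rcases k with _ | _ | k
      · exact absurd (Subsingleton.elim (α := Fin 1) i j) hne
      · rfl
      · exfalso
        simp only [Fin.val_one, Nat.mod_add_mod, Nat.add_assoc] at h₂
        rcases Nat.lt_or_ge (i.val + 2) (k + 3) with hlt | hge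
        · rw [Nat.mod_eq_of_lt (by omega)] at h₂
          omega
        · rw [Nat.mod_eq_sub_mod (by omega), Nat.mod_eq_of_lt (by omega)] at h₂
          omega
    subst hk
    rw [Fin.prod_univ_two]
    have h01 : c 1 = Dart.rev (c 0) := by
      obtain rfl | rfl : i = 0 ∨ i = 1 := by clear h₁ h₂ hrev hrev' hij hne; fin_cases i <;> simp
      · rwa [h₁, zero_add] at hrev
      · rwa [show j = 0 from h₁] at hrev'
    rw [h01, h.dartWeight_mul_rev]

/-- Induction on length: a repeated start vertex splits the walk into two strictly shorter closed
walks, and without repetition the preceding lemma applies. -/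
theorem Breakeven.prod_eq_one_of_closed (h : Λ.Breakeven) {u : V} {l : List (Dart A)}
    (hl : D.IsWalk u l u) : (l.map Λ.dartWeight).prod = 1 := by
  induction hn : l.length using Nat.strong_induction_on generalizing u l with
  | _ n ih =>
  by_cases hnd : (l.map D.start).Nodup
  · rcases n with _ | k
    · simp [List.length_eq_zero_iff.1 hn]
    · set c : Fin (k + 1) → Dart A := fun i => l[i.val]'(by omega) with hcdef
      have hlc : l = List.ofFn c := by
        refine List.ext_getElem (by simp [hn]) fun i _ _ => ?_
        simp only [List.getElem_ofFn, hcdef]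
      have hprod : (l.map Λ.dartWeight).prod = ∏ i, Λ.dartWeight (c i) := by
        rw [hlc, List.map_ofFn, List.prod_ofFn]
        rfl
      rw [hprod]
      refine h.prod_eq_one_of_vertex_injective (fun i => ?_) ?_
      · rcases Nat.lt_or_ge (i.val + 1) (k + 1) with hi | hi
        · have hv : (i + 1).val = i.val + 1 := Fin.val_add_one_of_lt' hi
          simp only [hcdef, hv]
          exact hl.finish_getElem _ _
        · have hi' : i = Fin.last k := Fin.ext (by simp; omega)
          have hv : (i + 1).val = 0 := by simp [hi']
          simp only [hcdef, hv]
          rw [hl.finish_last _ (by omega), hl.start_zero]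
      · rw [hlc, List.map_ofFn, List.nodup_ofFn] at hnd
        exact hnd
  · obtain ⟨l₁, x, l₂, y, l₃, rfl, hxy⟩ := List.exists_append_of_not_nodup_map _ hnd
    obtain ⟨w, hw₁, hw⟩ := D.isWalk_append.1 hl
    obtain ⟨w', hw₂, hw₃⟩ := D.isWalk_append.1 hw
    have hww : w' = w := by rw [← hw₃.1, ← hw₂.1, hxy]
    subst hww
    have e₁ := ih _ (by simp at hn ⊢; omega) hw₂ rfl
    have e₂ := ih _ (by simp at hn ⊢; omega) (D.isWalk_append.2 ⟨_, hw₁, hw₃⟩) rfl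
    rw [List.map_append, List.prod_append] at e₂ ⊢
    rw [List.map_append, List.prod_append, e₁, one_mul, e₂]

end ArcParam

/-- Carrying both directions through the induction makes the symmetric case a swap, so no walk has
to be reversed. -/
theorem exists_isWalk_of_eqvGen (D : MultiDigraph V A) {u v : V}
    (h : Relation.EqvGen (fun u v => ∃ a : A, D.src a = u ∧ D.dst a = v) u v) :
    (∃ l, D.IsWalk u l v) ∧ ∃ l, D.IsWalk v l u := by
  induction h with
  | rel u v h =>
    obtain ⟨a, rfl, rfl⟩ := h
    exact ⟨⟨[(a, true)], by simp [IsWalk, start, finish, Dart.rev]⟩,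
      ⟨[(a, false)], by simp [IsWalk, start, finish, Dart.rev]⟩⟩
  | refl u => exact ⟨⟨[], rfl⟩, ⟨[], rfl⟩⟩
  | symm u v _ ih => exact ih.symm
  | trans u v w _ _ ih₁ ih₂ =>
    obtain ⟨⟨p, hp⟩, ⟨p', hp'⟩⟩ := ih₁
    obtain ⟨⟨q, hq⟩, ⟨q', hq'⟩⟩ := ih₂
    exact ⟨⟨_, D.isWalk_append.2 ⟨_, hp, hq⟩⟩, ⟨_, D.isWalk_append.2 ⟨_, hq', hp'⟩⟩⟩

/-- The weights of a breakeven parameterization are the quotients of a positive potential. -/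
theorem ArcParam.Breakeven.exists_potential {D : MultiDigraph V A} {Λ : D.ArcParam}
    (h : Λ.Breakeven) :
    ∃ q : V → ℝ, (∀ v, 0 < q v) ∧ ∀ a, Λ.val a * q (D.src a) = q (D.dst a) := by
  set r : V → V → Prop := fun u v => ∃ a : A, D.src a = u ∧ D.dst a = v with hr
  have hreach (v : V) : (∃ l, D.IsWalk (Quot.mk r v).out l v)
      ∧ ∃ l, D.IsWalk v l (Quot.mk r v).out :=
    D.exists_isWalk_of_eqvGen (Quot.eqvGen_exact (Quot.out_eq _))
  choose p hp using fun v => (hreach v).1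
  choose b hb using fun v => (hreach v).2
  have hpos (l : List (Dart A)) : 0 < (l.map Λ.dartWeight).prod :=
    List.prod_pos fun x hx => by
      obtain ⟨d, -, rfl⟩ := List.mem_map.1 hx
      exact h.dartWeight_pos d
  -- The potential at `v` is the weight of a chosen walk to `v` from the representative of its
  -- component.
  refine ⟨fun v => ((p v).map Λ.dartWeight).prod, fun v => hpos _, fun a => ?_⟩
  have hq : Quot.mk r (D.src a) = Quot.mk r (D.dst a) := Quot.sound ⟨a, rfl, rfl⟩
  have hsrc := hp (D.src a)
  rw [hq] at hsrc
  -- The same return walk closes both the chosen walk to `D.dst a` and the one to `D.src a` extended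
  -- by `a`, so these two have equal weight.
  have e₁ := h.prod_eq_one_of_closed (D.isWalk_append.2 ⟨_, hp (D.dst a), hb (D.dst a)⟩)
  have e₂ := h.prod_eq_one_of_closed (D.isWalk_append.2 ⟨_, hsrc,
    (show D.IsWalk (D.src a) ((a, true) :: b (D.dst a)) _ from
      ⟨by simp [start], by simpa [finish, start, Dart.rev] using hb (D.dst a)⟩)⟩)
  rw [List.map_append, List.prod_append] at e₁ e₂
  rw [List.map_cons, List.prod_cons] at e₂
  have hw : Λ.dartWeight (a, true) = Λ.val a := by simp [dartWeight]
  rw [hw] at e₂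
  apply mul_right_cancel₀ (hpos (b (D.dst a))).ne'
  rw [e₁, ← e₂]
  ring

/-- Scaling by a potential turns generalized flows into flows. -/
theorem ArcParam.mem_flows_iff_of_potential {D : MultiDigraph V A} [DecidableEq V] [Fintype A]
    (Λ : D.ArcParam) {q : V → ℝ} (hq : ∀ v, 0 < q v)
    (hqΛ : ∀ a, Λ.val a * q (D.src a) = q (D.dst a)) (f : A → ℝ) :
    f ∈ Λ.flows ↔ (fun a => q (D.dst a) * f a) ∈ D.unitParam.flows := by
  rw [mem_flows_iff, mem_flows_iff]
  refine forall_congr' fun v => ?_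
  -- After scaling by `q v`, an outgoing arc has coefficient `q (D.src a) * Λ.val a = q (D.dst a)`,
  -- the same as at its head.
  rw [← mul_right_inj' (hq v).ne', mul_zero, Finset.mul_sum]
  refine Eq.congr_left (Finset.sum_congr rfl fun a _ => ?_)
  rw [mul_sub]
  congr 1
  · split_ifs with h
    · rw [h]
    · simp
  · split_ifs with h
    · rw [← hqΛ, h]
      simp only [unitParam]
      ring
    · simp

end MultiDigraph

theorem theorem8 {V A F : Type*} [Fintype V] [Fintype A] [Fintype F]
    [DecidableEq V] [DecidableEq A] [DecidableEq F]
    (D : MultiDigraph V A) (Λ : D.ArcParam) (hΛ : Λ.Breakeven) (E : D.SphereEmbedding F) :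
    ∃ Λ' : E.dual.ArcParam,
      Nonempty (Λ.flows ≃ₗ[ℝ] Λ'.bonds) ∧
      ∃ σ : A → ℝ, (∀ a, 0 < σ a) ∧
        ∀ f : A → ℝ, f ∈ Λ.flows ↔ (Matrix.diagonal σ).mulVec f ∈ Λ'.bonds := by
  obtain ⟨q, hq, hqΛ⟩ := hΛ.exists_potential
  have key (f : A → ℝ) : f ∈ Λ.flows ↔
      (fun a => q (D.dst a) * f a) ∈ E.dual.unitParam.bonds := by
    rw [E.bonds_dual_eq_flows, Λ.mem_flows_iff_of_potential hq hqΛ]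
  refine ⟨E.dual.unitParam, ⟨?_⟩, fun a => q (D.dst a), fun a => hq _, fun f => ?_⟩
  · let e : (A → ℝ) ≃ₗ[ℝ] (A → ℝ) := LinearEquiv.piCongrRight fun a =>
      LinearEquiv.smulOfNeZero ℝ ℝ (q (D.dst a)) (hq _).ne'
    refine e.ofSubmodules _ _ ?_
    ext x
    rw [Submodule.mem_map_equiv, key]
    have hx : (fun a => q (D.dst a) * e.symm x a) = x := e.apply_symm_apply x
    rw [hx]
  · have hf : (Matrix.diagonal fun a => q (D.dst a)).mulVec f = fun a => q (D.dst a) * f a :=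
      funext fun a => Matrix.mulVec_diagonal _ _ _
    rw [hf, key]
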